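/- For $M\in\mathbb{N}$ and $\sigma^2>0$ let $\mathrm{E}$ be a random real $M\times M$ matrix whose entries are independent centered Gaussian variables with variance $\sigma^2$; for $C\in\mathbb{R}^{M\times M}$ put $X=C+\mathrm{E}$. Let $\|\cdot\|_{S_2}$ be the Hilbert-Schmidt (Frobenius) norm, let $\mathcal{S}_{M,1}$ be the set of all $M\times M$ matrices of orthogonal projections onto one-dimensional subspaces of $\mathbb{R}^M$, let $\hat\pi_1$ be a maximizer of $\tilde\pi\mapsto\|\tilde\pi X\|_{S_2}^2$ over $\mathcal{S}_{M,1}$ and $\pi_1$ a maximizer of $\tilde\pi\mapsto\mathbf{E}\|\tilde\pi X\|_{S_2}^2$ over $\mathcal{S}_{M,1}$, and define $$\delta_{C,M,\sigma^2,1}:=\mathbf{E}\|\hat\pi_1X\|_{S_2}^2-\mathbf{E}\|\pi_1X\|_{S_2}^2 .$$ Then there exist an absolute constant $c>0$ and an $M_0\in\mathbb{N}$, neither depending on $\sigma^2$, such that for all $M\ge M_0$ and all $\sigma^2>0$ the expectations in this definition are finite for every $C$, and $$\inf_{C\in\mathbb{R}^{M\times M}}\delta_{C,M,\sigma^2,1}\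 \ge\ c\,\delta_{0,M,\sigma^2,1}\qquad\text{and}\qquad \inf_{C\in\mathbb{R}^{M\times M}}\delta_{C,M,\sigma^2,1}\ \ge\ c\,\sigma^2M .$$ Consequently, for the largest singular values $\hat\lambda_1$ of $X$ and $\lambda_1$ of $C$, one has $\mathbf{E}\hat\lambda_1^2-\sigma^2M-\lambda_1^2\ge c\,\sigma^2M$ for every $C\in\mathbb{R}^{M\times M}$. -/

import Mathlib

open MeasureTheory ProbabilityTheory
open scoped NNReal

noncomputable section

namespace RankProjection

/-- The squared Hilbert-Schmidt (Frobenius) norm of a real matrix. -/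
def hsNormSq {M : ℕ} (A : Matrix (Fin M) (Fin M) ℝ) : ℝ :=
  ∑ i, ∑ j, A i j ^ 2

/-- The set of all `M × M` matrices representing orthogonal projections onto `r`-dimensional
linear subspaces of `ℝ^M`. -/
def orthProj (M r : ℕ) : Set (Matrix (Fin M) (Fin M) ℝ) :=
  {P | IsStarProjection P ∧ P.rank = r}

open Classical in
/-- A maximizer of `f` over the rank-`r` orthogonal projections (some choice of it). It exists for
continuous `f` and `r ≤ M`, see `argmaxProj_spec`; the value `0` is used if there is none. -/
def argmaxProj {M : ℕ} (r : ℕ) (f : Matrix (Fin M) (Fin M) ℝ → ℝ) : Matrix (Fin M) (Fin M) ℝ :=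
  if h : ∃ P ∈ orthProj M r, IsMaxOn f (orthProj M r) P then h.choose else 0

/-- The empirical projection: a maximizer of `P ↦ ‖P X‖²` for a given matrix `X`. -/
def empiricalProj {M : ℕ} (r : ℕ) (X : Matrix (Fin M) (Fin M) ℝ) : Matrix (Fin M) (Fin M) ℝ :=
  argmaxProj r fun P => hsNormSq (P * X)

/-- The population projection: a maximizer of `P ↦ 𝐄 ‖P X‖²` for a given random matrix `X`. -/
def populationProj {M : ℕ} {Ω : Type*} [MeasurableSpace Ω] (μ : Measure Ω) (r : ℕ)
    (X : Ω → Matrix (Fin M) (Fin M) ℝ) : Matrix (Fin M) (Fin M) ℝ :=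
  argmaxProj r fun P => ∫ ω, hsNormSq (P * X ω) ∂μ

/-- The accuracy of approximation `𝐄 ‖π̂_r X‖² - 𝐄 ‖π_r X‖²` in the model `X = C + E`. -/
def delta {M : ℕ} {Ω : Type*} [MeasurableSpace Ω] (μ : Measure Ω)
    (E : Ω → Matrix (Fin M) (Fin M) ℝ) (C : Matrix (Fin M) (Fin M) ℝ) (r : ℕ) : ℝ :=
  ∫ ω, hsNormSq (empiricalProj r (C + E ω) * (C + E ω)) ∂μ
    - ∫ ω, hsNormSq (populationProj μ r (fun ω' => C + E ω') * (C + E ω)) ∂μ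

/-- `E` is a random matrix whose entries are independent centered Gaussians of variance `v`. -/
structure IsGaussianMatrix {M : ℕ} {Ω : Type*} [MeasurableSpace Ω] (μ : Measure Ω) (v : ℝ≥0)
    (E : Ω → Matrix (Fin M) (Fin M) ℝ) : Prop where
  hasLaw : ∀ i j, HasLaw (fun ω => E ω i j) (gaussianReal 0 v) μ
  indep : iIndepFun (fun (p : Fin M × Fin M) ω => E ω p.1 p.2) μ

/-- The largest singular value of a square matrix. -/
def topSingularValue {M : ℕ} (A : Matrix (Fin M) (Fin M) ℝ) : ℝ :=
  (Matrix.toEuclideanLin A).singularValues 0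

theorem rank_eq_trace {M : ℕ} {P : Matrix (Fin M) (Fin M) ℝ} (hP : P * P = P) :
    (P.rank : ℝ) = P.trace := by
  have hid : IsIdempotentElem (Matrix.toLin' P) := by
    change Matrix.toLin' P * Matrix.toLin' P = Matrix.toLin' P
    rw [Module.End.mul_eq_comp, ← Matrix.toLin'_mul, hP]
  have h := (LinearMap.IsIdempotentElem.isProj_range _ hid).trace
  rw [Matrix.trace_toLin'_eq] at h
  rw [h]
  rfl

theorem isCompact_orthProj (M r : ℕ) : IsCompact (orthProj M r) := by
  have heq : orthProj M r
      = {P | P * P = P} ∩ {P | P.transpose = P} ∩ {P | P.trace = (r : ℝ)} := by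
    ext P
    simp only [orthProj, Set.mem_ofPred_eq, Set.mem_inter_iff]
    constructor
    · rintro ⟨⟨h1, h2⟩, h3⟩
      refine ⟨⟨h1, ?_⟩, ?_⟩
      · have h2' : P.conjTranspose = P := h2
        simpa using h2'
      · rw [← rank_eq_trace h1, h3]
    · rintro ⟨⟨h1, h2⟩, h3⟩
      refine ⟨⟨h1, ?_⟩, ?_⟩
      · change P.conjTranspose = P
        simpa using h2
      · rw [← rank_eq_trace h1] at h3
        exact_mod_cast h3
  have hclosed : IsClosed (orthProj M r) := by
    rw [heq]
    refine ((isClosed_eq (by fun_prop) (by fun_prop)).inter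
      (isClosed_eq (by fun_prop) (by fun_prop))).inter (isClosed_eq (by fun_prop) (by fun_prop))
  have hbox : IsCompact (Set.univ.pi fun _ : Fin M => Set.univ.pi fun _ : Fin M =>
      Set.Icc (-1 : ℝ) 1) :=
    isCompact_univ_pi fun _ => isCompact_univ_pi fun _ => isCompact_Icc
  refine hbox.of_isClosed_subset hclosed ?_
  intro (P : Matrix (Fin M) (Fin M) ℝ) hP
  rw [heq] at hP
  obtain ⟨⟨h1, h2⟩, -⟩ := hP
  change P * P = P at h1
  change P.transpose = P at h2
  have hsym : ∀ i j, P i j = P j i := fun i j => congrFun (congrFun h2.symm i) j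
  have hdiag : ∀ i, P i i = ∑ k, P i k ^ 2 := by
    intro i
    have h := congrFun (congrFun h1 i) i
    rw [Matrix.mul_apply] at h
    rw [← h]
    exact Finset.sum_congr rfl fun k _ => by rw [hsym k i, sq]
  have hle : ∀ i j, P i j ^ 2 ≤ P i i := by
    intro i j
    rw [hdiag i]
    exact Finset.single_le_sum (f := fun k => P i k ^ 2) (fun k _ => sq_nonneg _)
      (Finset.mem_univ j)
  intro i _ j _
  have h3 := hle i i
  have h4 := hle i j
  have h5 : P i i ≤ 1 := by nlinarith
  exact abs_le.mp ((sq_le_one_iff_abs_le_one (P i j)).mp (h4.trans h5))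

theorem orthProj_nonempty {M r : ℕ} (h : r ≤ M) : (orthProj M r).Nonempty := by
  refine ⟨Matrix.diagonal fun i : Fin M => if (i : ℕ) < r then 1 else 0, ⟨?_, ?_⟩, ?_⟩
  · change _ * _ = _
    rw [Matrix.diagonal_mul_diagonal]
    congr 1
    funext i
    split_ifs <;> simp
  · change Matrix.conjTranspose _ = _
    rw [Matrix.diagonal_conjTranspose]
    simp
  · have hidem : (Matrix.diagonal fun i : Fin M => if (i : ℕ) < r then (1 : ℝ) else 0) *
        (Matrix.diagonal fun i : Fin M => if (i : ℕ) < r then (1 : ℝ) else 0) =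
        Matrix.diagonal fun i : Fin M => if (i : ℕ) < r then (1 : ℝ) else 0 := by
      rw [Matrix.diagonal_mul_diagonal]
      congr 1
      funext i
      split_ifs <;> simp
    have h1 := rank_eq_trace hidem
    rw [Matrix.trace_diagonal, Fin.sum_univ_eq_sum_range (fun i => if i < r then (1 : ℝ) else 0),
      Finset.sum_ite, Finset.sum_const_zero, add_zero, Finset.sum_const, nsmul_eq_mul, mul_one] at h1
    have h2 : (Finset.range M).filter (fun i => i < r) = Finset.range r := by
      ext i
      simp only [Finset.mem_filter, Finset.mem_range]
      omega
    rw [h2, Finset.card_range] at h1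
    exact_mod_cast h1

/-- The maximizer exists, so that `argmaxProj` has its intended meaning. -/
theorem argmaxProj_spec {M r : ℕ} (h : r ≤ M) {f : Matrix (Fin M) (Fin M) ℝ → ℝ}
    (hf : ContinuousOn f (orthProj M r)) :
    argmaxProj r f ∈ orthProj M r ∧ IsMaxOn f (orthProj M r) (argmaxProj r f) := by
  have hex := (isCompact_orthProj M r).exists_isMaxOn (orthProj_nonempty h) hf
  rw [argmaxProj, dif_pos hex]
  exact hex.choose_spec

end RankProjection

end

/-! The best one-dimensional projection captures the squared top singular value, and noise adds `v *
M` to the expected energy of every fixed one-dimensional projection. Hence `delta` equals 𝐄 s₁(C +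
E)² − v M − s₁(C)² (`delta_eq`), and both bounds follow once this is at least of order v M for every
C and at most of order v M for C = 0.

Lower bound (`integral_topSingularValue_sq_ge`). By rotation invariance of the noise, C may be
assumed to have row 0 equal to (s, 0, …, 0), with s = s₁(C). Any unit vector w gives s₁(X)² ≥ ‖X
w‖², and w may depend on the noise. Choose it as a function of row 0 of E alone, combining the first
basis vector with the signs of that row. With κ = 𝐄|N(0,1)| and d = M − 1, row 0 then contributes at
least s² + d κ² v. Each other row is independent of w and still contributes at least v. The excess
over s² + v M is (d κ² − 1) v, uniformly in C.

Upper bound at C = 0 (`integral_topSingularValue_sq_le`). The bilinear form of E is at least s₁/4 on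
a ball of radius 1/4 around a singular pair. Averaging its exponential over a larger ball therefore
bounds an exponential moment of s₁, at the cost of a volume ratio 25 ^ M. This replaces a net
argument. -/

noncomputable section

namespace RankProjection

open Matrix
open scoped Kronecker

/-! ### Top singular value and rank-one projections -/

section

variable {M : ℕ}

theorem topSingularValue_nonneg (A : Matrix (Fin M) (Fin M) ℝ) : 0 ≤ topSingularValue A :=
  LinearMap.singularValues_nonneg _ _

theorem real_norm_sq_eq_dotProduct (x : EuclideanSpace ℝ (Fin M)) :
    ‖x‖ ^ 2 = x.ofLp ⬝ᵥ x.ofLp := by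
  rw [EuclideanSpace.real_norm_sq_eq, dotProduct]
  exact Finset.sum_congr rfl fun i _ => sq _

/-- The quadratic form of `AᵀA` is bounded by the square of the largest singular value. -/
theorem mulVec_dotProduct_mulVec_le (A : Matrix (Fin M) (Fin M) ℝ) (x : Fin M → ℝ) :
    (A *ᵥ x) ⬝ᵥ (A *ᵥ x) ≤ topSingularValue A ^ 2 * (x ⬝ᵥ x) := by
  set T := Matrix.toEuclideanLin A with hT
  have hn : Module.finrank ℝ (EuclideanSpace ℝ (Fin M)) = M := by simp
  have hS := T.isSymmetric_adjoint_comp_self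
  set b := hS.eigenvectorBasis hn with hb
  set y : EuclideanSpace ℝ (Fin M) := WithLp.toLp 2 x with hy
  have h1 : (A *ᵥ x) ⬝ᵥ (A *ᵥ x) = inner ℝ y ((T.adjoint ∘ₗ T) y) := by
    rw [LinearMap.comp_apply, LinearMap.adjoint_inner_right, real_inner_self_eq_norm_sq,
      real_norm_sq_eq_dotProduct]
    simp [hT, hy]
  have h2 : x ⬝ᵥ x = inner ℝ y y := by
    rw [real_inner_self_eq_norm_sq, real_norm_sq_eq_dotProduct]
  -- Expand in an eigenbasis of A*A: its eigenvalues are the squared singular values in decreasing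
  -- order, so the first one dominates.
  rw [h1, h2, ← b.sum_inner_mul_inner y y, ← b.sum_inner_mul_inner y, Finset.mul_sum]
  refine Finset.sum_le_sum fun i _ => ?_
  have h3 : inner ℝ (b i) ((T.adjoint ∘ₗ T) y) = hS.eigenvalues hn i * inner ℝ (b i) y := by
    rw [← hS, hb, hS.apply_eigenvectorBasis]
    simp [inner_smul_left]
  rw [h3, ← T.sq_singularValues_fin hn i, real_inner_comm (b i) y]
  have h4 : T.singularValues i ^ 2 ≤ topSingularValue A ^ 2 :=
    pow_le_pow_left₀ (T.singularValues_nonneg _) (T.singularValues_antitone (Nat.zero_le _)) 2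
  nlinarith [mul_self_nonneg (inner ℝ (b i) y)]

/-- With y = Aᵀx, Cauchy–Schwarz gives ‖y‖² = ⟨x, Ay⟩ ≤ ‖x‖ s ‖y‖, and ‖y‖ cancels unless it is
zero. -/
theorem transpose_mulVec_dotProduct_le (A : Matrix (Fin M) (Fin M) ℝ) (x : Fin M → ℝ) :
    (Aᵀ *ᵥ x) ⬝ᵥ (Aᵀ *ᵥ x) ≤ topSingularValue A ^ 2 * (x ⬝ᵥ x) := by
  set y := Aᵀ *ᵥ x with hy
  have h1 : y ⬝ᵥ y = x ⬝ᵥ (A *ᵥ y) := by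
    have hy' : y = x ᵥ* A := mulVec_transpose A x
    calc y ⬝ᵥ y = (x ᵥ* A) ⬝ᵥ y := by rw [← hy']
      _ = x ⬝ᵥ (A *ᵥ y) := (dotProduct_mulVec _ _ _).symm
  have h2 := mulVec_dotProduct_mulVec_le A y
  have h3 : (x ⬝ᵥ (A *ᵥ y)) ^ 2 ≤ (x ⬝ᵥ x) * ((A *ᵥ y) ⬝ᵥ (A *ᵥ y)) := by
    have := Finset.sum_mul_sq_le_sq_mul_sq Finset.univ x (A *ᵥ y)
    simpa [dotProduct, sq] using this
  have hx : 0 ≤ x ⬝ᵥ x := Finset.sum_nonneg fun i _ => mul_self_nonneg _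
  have h0 : 0 ≤ y ⬝ᵥ y := Finset.sum_nonneg fun i _ => mul_self_nonneg _
  rcases h0.eq_or_lt with h | h
  · rw [← h]; positivity
  · rw [← h1] at h3
    have : (y ⬝ᵥ y) ^ 2 ≤ (topSingularValue A ^ 2 * (x ⬝ᵥ x)) * (y ⬝ᵥ y) := by
      nlinarith [mul_le_mul_of_nonneg_left h2 hx]
    rw [sq] at this
    exact le_of_mul_le_mul_right this h

/-- A pair of unit singular vectors for the largest singular value. -/
theorem exists_singular_pair (hM : 0 < M) (A : Matrix (Fin M) (Fin M) ℝ) :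
    ∃ u w : Fin M → ℝ, u ⬝ᵥ u = 1 ∧ w ⬝ᵥ w = 1 ∧ Aᵀ *ᵥ u = topSingularValue A • w ∧
      A *ᵥ w = topSingularValue A • u := by
  set T := Matrix.toEuclideanLin A with hT
  have hn : Module.finrank ℝ (EuclideanSpace ℝ (Fin M)) = M := by simp
  have hS := T.isSymmetric_adjoint_comp_self
  set s := topSingularValue A with hs
  set w : Fin M → ℝ := (hS.eigenvectorBasis hn ⟨0, hM⟩).ofLp with hw
  have hww : w ⬝ᵥ w = 1 := by
    rw [← real_norm_sq_eq_dotProduct, OrthonormalBasis.norm_eq_one, one_pow]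
  have hAA : Aᵀ *ᵥ (A *ᵥ w) = s ^ 2 • w := by
    have h := hS.apply_eigenvectorBasis hn ⟨0, hM⟩
    rw [← T.sq_singularValues_fin hn] at h
    rw [LinearMap.comp_apply] at h
    change _ = s ^ 2 • _ at h
    have hadj : LinearMap.adjoint T = Matrix.toEuclideanLin Aᴴ :=
      (Matrix.toEuclideanLin_conjTranspose_eq_adjoint A).symm
    generalize hS.eigenvectorBasis hn ⟨0, hM⟩ = e at h hw
    rw [hadj, hT] at h
    have h' := congrArg WithLp.ofLp h
    simpa [hw] using h'
  rcases (topSingularValue_nonneg A).eq_or_lt with h | h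
  · -- all singular values vanish
    have hz : ∀ x, A *ᵥ x = 0 := fun x => by
      have := mulVec_dotProduct_mulVec_le A x
      rw [← h] at this
      refine dotProduct_self_eq_zero.1 (le_antisymm (by simpa using this) ?_)
      exact Finset.sum_nonneg fun i _ => mul_self_nonneg _
    have hz' : ∀ x, Aᵀ *ᵥ x = 0 := fun x => by
      have := transpose_mulVec_dotProduct_le A x
      rw [← h] at this
      refine dotProduct_self_eq_zero.1 (le_antisymm (by simpa using this) ?_)
      exact Finset.sum_nonneg fun i _ => mul_self_nonneg _
    exact ⟨w, w, hww, hww, by rw [hz', ← h.trans hs.symm, zero_smul],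
      by rw [hz, ← h.trans hs.symm, zero_smul]⟩
  · have hs0 : s ≠ 0 := h.ne'
    refine ⟨s⁻¹ • (A *ᵥ w), w, ?_, hww, ?_, ?_⟩
    · have h1 : (A *ᵥ w) ⬝ᵥ (A *ᵥ w) = s ^ 2 := by
        rw [dotProduct_mulVec, ← mulVec_transpose, hAA, smul_dotProduct, hww]
        simp
      rw [smul_dotProduct, dotProduct_smul, h1]
      simp only [smul_eq_mul]
      field_simp
    · rw [mulVec_smul, hAA, smul_smul]
      congr 1
      field_simp
    · rw [smul_smul, mul_inv_cancel₀ hs0, one_smul]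

/-- Row i of P X is Xᵀ applied to row i of P, so the bound for Xᵀ can be summed over rows. -/
theorem hsNormSq_mul_le (P X : Matrix (Fin M) (Fin M) ℝ) :
    hsNormSq (P * X) ≤ topSingularValue X ^ 2 * hsNormSq P := by
  unfold hsNormSq
  rw [Finset.mul_sum]
  refine Finset.sum_le_sum fun i _ => ?_
  have := transpose_mulVec_dotProduct_le X (P i)
  rw [mulVec_transpose] at this
  simpa [dotProduct, sq, vecMul, Matrix.mul_apply] using this

theorem hsNormSq_orthProj {r : ℕ} {P : Matrix (Fin M) (Fin M) ℝ} (hP : P ∈ orthProj M r) :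
    hsNormSq P = r := by
  obtain ⟨⟨h1, h2⟩, h3⟩ := hP
  have h1' : P * P = P := h1
  have h2' : Pᵀ = P := by
    have : P.conjTranspose = P := h2
    simpa using this
  rw [← h3, rank_eq_trace h1', hsNormSq, Matrix.trace]
  refine Finset.sum_congr rfl fun i _ => ?_
  conv_rhs => rw [Matrix.diag_apply, ← h1', Matrix.mul_apply]
  refine Finset.sum_congr rfl fun j _ => ?_
  rw [sq]
  congr 1
  exact congrFun (congrFun h2' j) i ▸ rfl

theorem vecMulVec_self_mem_orthProj {u : Fin M → ℝ} (hu : u ⬝ᵥ u = 1) :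
    vecMulVec u u ∈ orthProj M 1 := by
  have h1 : vecMulVec u u * vecMulVec u u = vecMulVec u u := by
    rw [vecMulVec_mul_vecMulVec, hu]; simp
  refine ⟨⟨h1, ?_⟩, ?_⟩
  · change Matrix.conjTranspose _ = _
    ext i j
    simp [vecMulVec_apply, mul_comm]
  · have := rank_eq_trace h1
    rw [Matrix.trace_vecMulVec, hu] at this
    exact_mod_cast this

/-- Project onto the top left singular vector u: u uᵀ X = s u wᵀ, which has norm s. -/
theorem exists_orthProj_hsNormSq_mul (hM : 0 < M) (X : Matrix (Fin M) (Fin M) ℝ) :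
    ∃ P ∈ orthProj M 1, hsNormSq (P * X) = topSingularValue X ^ 2 := by
  obtain ⟨u, w, hu, hw, h1, -⟩ := exists_singular_pair hM X
  refine ⟨vecMulVec u u, vecMulVec_self_mem_orthProj hu, ?_⟩
  rw [mulVec_transpose] at h1
  rw [vecMulVec_mul, h1]
  have h2 : ∀ i j, (vecMulVec u (topSingularValue X • w) i j) ^ 2
      = topSingularValue X ^ 2 * ((u i * u i) * (w j * w j)) := fun i j => by
    simp [vecMulVec_apply]; ring
  simp_rw [hsNormSq, h2, ← Finset.mul_sum, ← Finset.sum_mul]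
  rw [dotProduct] at hu hw
  rw [hw, mul_one, hu, mul_one]

theorem continuous_hsNormSq_mul (X : Matrix (Fin M) (Fin M) ℝ) :
    Continuous fun P : Matrix (Fin M) (Fin M) ℝ => hsNormSq (P * X) := by
  unfold hsNormSq
  fun_prop

/-- The empirical projection captures the square of the largest singular value. -/
theorem hsNormSq_empiricalProj_mul (hM : 0 < M) (X : Matrix (Fin M) (Fin M) ℝ) :
    hsNormSq (empiricalProj 1 X * X) = topSingularValue X ^ 2 := by
  obtain ⟨h1, h2⟩ := argmaxProj_spec (r := 1) hM (continuous_hsNormSq_mul X).continuousOn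
  obtain ⟨P, hP, hPX⟩ := exists_orthProj_hsNormSq_mul hM X
  refine le_antisymm ?_ ?_
  · refine (hsNormSq_mul_le _ _).trans ?_
    rw [empiricalProj, hsNormSq_orthProj h1]; simp
  · rw [← hPX]; exact h2 hP

/-- Supplies the integrable majorant for the squared top singular value of a noisy matrix. -/
theorem topSingularValue_sq_le_hsNormSq (hM : 0 < M) (X : Matrix (Fin M) (Fin M) ℝ) :
    topSingularValue X ^ 2 ≤ hsNormSq X := by
  obtain ⟨u, w, hu, hw, -, h1⟩ := exists_singular_pair hM X
  have h2 : topSingularValue X ^ 2 = ∑ i, (X *ᵥ w) i ^ 2 := by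
    rw [h1]
    simp_rw [Pi.smul_apply, smul_eq_mul, mul_pow, ← Finset.mul_sum]
    rw [dotProduct] at hu
    simp_rw [sq (u _), hu, mul_one]
  rw [h2, hsNormSq]
  refine Finset.sum_le_sum fun i _ => ?_
  have := Finset.sum_mul_sq_le_sq_mul_sq Finset.univ (X i) w
  rw [dotProduct] at hw
  simp_rw [sq (w _), hw, mul_one] at this
  exact this

/-- The largest singular value is the Euclidean operator norm. -/
theorem topSingularValue_eq_norm (hM : 0 < M) (A : Matrix (Fin M) (Fin M) ℝ) :
    topSingularValue A = ‖Matrix.toEuclideanCLM (𝕜 := ℝ) A‖ := by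
  refine le_antisymm ?_ ?_
  · obtain ⟨u, w, hu, hw, -, h1⟩ := exists_singular_pair hM A
    have hw' : ‖(WithLp.toLp 2 w : EuclideanSpace ℝ (Fin M))‖ = 1 := by
      rw [← sq_eq_sq₀ (norm_nonneg _) zero_le_one, real_norm_sq_eq_dotProduct, hw, one_pow]
    have hu' : ‖(WithLp.toLp 2 u : EuclideanSpace ℝ (Fin M))‖ = 1 := by
      rw [← sq_eq_sq₀ (norm_nonneg _) zero_le_one, real_norm_sq_eq_dotProduct, hu, one_pow]
    have h2 := (Matrix.toEuclideanCLM (𝕜 := ℝ) A).le_opNorm (WithLp.toLp 2 w)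
    rw [Matrix.toEuclideanCLM_toLp, h1, hw', mul_one, WithLp.toLp_smul, norm_smul, hu', mul_one,
      Real.norm_of_nonneg (topSingularValue_nonneg A)] at h2
    exact h2
  · refine ContinuousLinearMap.opNorm_le_bound _ (topSingularValue_nonneg A) fun x => ?_
    refine le_of_sq_le_sq ?_ (mul_nonneg (topSingularValue_nonneg A) (norm_nonneg _))
    rw [mul_pow, real_norm_sq_eq_dotProduct, real_norm_sq_eq_dotProduct]
    exact mulVec_dotProduct_mulVec_le A x.ofLp

theorem continuous_topSingularValue (hM : 0 < M) :
    Continuous (topSingularValue : Matrix (Fin M) (Fin M) ℝ → ℝ) := by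
  have : (topSingularValue : Matrix (Fin M) (Fin M) ℝ → ℝ) =
      fun A => ‖Matrix.toEuclideanCLM (n := Fin M) (𝕜 := ℝ) A‖ := funext (topSingularValue_eq_norm hM)
  rw [this]
  have : Continuous (Matrix.toEuclideanCLM (n := Fin M) (𝕜 := ℝ)) :=
    (Matrix.toEuclideanCLM (n := Fin M) (𝕜 := ℝ)).toAlgEquiv.toLinearEquiv.toLinearMap.continuous_of_finiteDimensional
  exact this.norm

end

/-! ### Gaussian matrices: rotation invariance, moments, formula for `delta` -/

section

/-- The centered isotropic Gaussian measure is invariant under orthogonal matrices. -/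
theorem pi_gaussianReal_map_mulVec {ι : Type*} [Fintype ι] [DecidableEq ι] (v : ℝ≥0)
    {O : Matrix ι ι ℝ} (hO : O * Oᵀ = 1) :
    (Measure.pi fun _ : ι => gaussianReal 0 v).map (fun x => O *ᵥ x)
      = Measure.pi fun _ : ι => gaussianReal 0 v := by
  have hm : Measurable fun x : ι → ℝ => O *ᵥ x :=
    (Continuous.matrix_mulVec continuous_const continuous_id).measurable
  -- The characteristic function depends on t only through its length, which Oᵀ preserves.
  have hchar : ∀ t : EuclideanSpace ℝ ι,
      charFun ((Measure.pi fun _ : ι => gaussianReal 0 v).map (WithLp.toLp 2)) t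
        = Complex.exp (-(v * (t.ofLp ⬝ᵥ t.ofLp) / 2 : ℝ)) := by
    intro t
    simp_rw [charFun_pi, charFun_gaussianReal, ← Complex.exp_sum]
    congr 1
    simp only [dotProduct, Complex.ofReal_div, Complex.ofReal_mul, Complex.ofReal_sum,
      Finset.mul_sum, Finset.sum_div, ← Finset.sum_neg_distrib]
    refine Finset.sum_congr rfl fun i _ => ?_
    push_cast
    ring
  have key : ((Measure.pi fun _ : ι => gaussianReal 0 v).map (fun x => O *ᵥ x)).map
      (MeasurableEquiv.toLp 2 (ι → ℝ))
        = (Measure.pi fun _ : ι => gaussianReal 0 v).map (MeasurableEquiv.toLp 2 (ι → ℝ)) := by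
    rw [MeasurableEquiv.coe_toLp]
    apply Measure.ext_of_charFun (E := EuclideanSpace ℝ ι)
    ext t
    have h1 : charFun (((Measure.pi fun _ : ι => gaussianReal 0 v).map (fun x => O *ᵥ x)).map
        (WithLp.toLp 2)) t
        = charFun ((Measure.pi fun _ : ι => gaussianReal 0 v).map (WithLp.toLp 2))
          (WithLp.toLp 2 (Oᵀ *ᵥ t.ofLp)) := by
      rw [Measure.map_map (by fun_prop) hm, charFun_apply, charFun_apply,
        integral_map (by fun_prop) (by fun_prop), integral_map (by fun_prop) (by fun_prop)]
      refine integral_congr_ae (Filter.Eventually.of_forall fun x => ?_)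
      simp only [Function.comp_apply, EuclideanSpace.inner_eq_star_dotProduct, star_trivial]
      rw [dotProduct_mulVec, ← mulVec_transpose]
    rw [h1, hchar, hchar]
    congr 3
    simp only
    rw [dotProduct_mulVec, ← mulVec_transpose, transpose_transpose, mulVec_mulVec, hO, one_mulVec]
  exact (MeasurableEquiv.toLp 2 (ι → ℝ)).map_measurableEquiv_injective key

variable {M : ℕ} {Ω : Type*} [MeasurableSpace Ω] {μ : Measure Ω} {v : ℝ≥0}
  {E : Ω → Matrix (Fin M) (Fin M) ℝ}

namespace IsGaussianMatrix

theorem aemeasurable (hE : IsGaussianMatrix μ v E) (i j : Fin M) :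
    AEMeasurable (fun ω => E ω i j) μ := (hE.hasLaw i j).aemeasurable

theorem hasLaw_pi [IsProbabilityMeasure μ] (hE : IsGaussianMatrix μ v E) :
    HasLaw (fun ω (p : Fin M × Fin M) => E ω p.1 p.2) (Measure.pi fun _ => gaussianReal 0 v) μ where
  aemeasurable := aemeasurable_pi_lambda _ fun p => hE.aemeasurable p.1 p.2
  map_eq := by
    refine ((iIndepFun_iff_map_fun_eq_pi_map (f := fun (p : Fin M × Fin M) ω => E ω p.1 p.2)
      fun p => hE.aemeasurable p.1 p.2).1 hE.indep).trans ?_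
    congr 1
    funext p
    exact (hE.hasLaw p.1 p.2).map_eq

theorem of_hasLaw_pi [IsProbabilityMeasure μ]
    (h : HasLaw (fun ω (p : Fin M × Fin M) => E ω p.1 p.2)
      (Measure.pi fun _ => gaussianReal 0 v) μ) : IsGaussianMatrix μ v E := by
  have hlaw : ∀ p : Fin M × Fin M, HasLaw (fun ω => E ω p.1 p.2) (gaussianReal 0 v) μ := fun p =>
    (measurePreserving_eval (fun _ : Fin M × Fin M => gaussianReal 0 v) p).hasLaw.comp h
  refine ⟨fun i j => hlaw (i, j), ?_⟩
  rw [iIndepFun_iff_map_fun_eq_pi_map fun p => (hlaw p).aemeasurable, h.map_eq]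
  congr 1
  funext p
  exact (hlaw p).map_eq.symm

/-- The law of a Gaussian matrix is invariant under orthogonal transformations on both sides. -/
theorem mul_mul [IsProbabilityMeasure μ] (hE : IsGaussianMatrix μ v E)
    {U V : Matrix (Fin M) (Fin M) ℝ} (hU : U * Uᵀ = 1) (hV : Vᵀ * V = 1) :
    IsGaussianMatrix μ v (fun ω => U * E ω * V) := by
  -- On matrices flattened to vectors, E ↦ U E V is multiplication by U ⊗ Vᵀ, which is again
  -- orthogonal.
  have hO : (U ⊗ₖ Vᵀ) * (U ⊗ₖ Vᵀ)ᵀ = 1 := by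
    rw [← kroneckerMap_transpose, transpose_transpose, ← mul_kronecker_mul, hU, hV,
      one_kronecker_one]
  have hm : Measurable fun x : Fin M × Fin M → ℝ => (U ⊗ₖ Vᵀ) *ᵥ x :=
    (Continuous.matrix_mulVec continuous_const continuous_id).measurable
  apply of_hasLaw_pi
  have h1 : (fun ω (p : Fin M × Fin M) => (U * E ω * V) p.1 p.2)
      = fun ω => (U ⊗ₖ Vᵀ) *ᵥ (fun p : Fin M × Fin M => E ω p.1 p.2) := by
    funext ω p
    simp only [mul_apply, mulVec, dotProduct, Fintype.sum_prod_type, kroneckerMap_apply,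
      transpose_apply, Finset.sum_mul]
    rw [Finset.sum_comm]
    exact Finset.sum_congr rfl fun i _ => Finset.sum_congr rfl fun j _ => by ring
  rw [h1]
  have h2 : HasLaw (fun x : Fin M × Fin M → ℝ => (U ⊗ₖ Vᵀ) *ᵥ x)
      (Measure.pi fun _ => gaussianReal 0 v) (Measure.pi fun _ => gaussianReal 0 v) :=
    ⟨hm.aemeasurable, pi_gaussianReal_map_mulVec v hO⟩
  exact h2.comp hE.hasLaw_pi

theorem memLp_two (hE : IsGaussianMatrix μ v E) (i j : Fin M) :
    MemLp (fun ω => E ω i j) 2 μ := by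
  have h := memLp_id_gaussianReal (μ := 0) (v := v) 2
  rw [← (hE.hasLaw i j).map_eq] at h
  exact (memLp_map_measure_iff (by fun_prop) (hE.aemeasurable i j)).1 h

theorem memLp_two_add (hE : IsGaussianMatrix μ v E) [IsProbabilityMeasure μ] (c : ℝ) (i j : Fin M) :
    MemLp (fun ω => c + E ω i j) 2 μ :=
  (memLp_const c).add (hE.memLp_two i j)

theorem integral_eq_zero (hE : IsGaussianMatrix μ v E) (i j : Fin M) :
    ∫ ω, E ω i j ∂μ = 0 := by
  rw [(hE.hasLaw i j).integral_eq, integral_id_gaussianReal]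

theorem integral_mul_eq [IsProbabilityMeasure μ] (hE : IsGaussianMatrix μ v E)
    (p q : Fin M × Fin M) :
    ∫ ω, E ω p.1 p.2 * E ω q.1 q.2 ∂μ = if p = q then (v : ℝ) else 0 := by
  split_ifs with h
  · subst h
    have h1 := (hE.hasLaw p.1 p.2).variance_eq
    rw [variance_id_gaussianReal, variance_eq_sub (hE.memLp_two _ _), hE.integral_eq_zero] at h1
    simp only [Pi.pow_apply, sq] at h1
    simpa using h1
  · rw [(hE.indep.indepFun h).integral_fun_mul_eq_mul_integral
      (hE.aemeasurable _ _).aestronglyMeasurable (hE.aemeasurable _ _).aestronglyMeasurable,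
      hE.integral_eq_zero, zero_mul]

theorem integral_add_mul_add [IsProbabilityMeasure μ] (hE : IsGaussianMatrix μ v E)
    (a b : ℝ) (p q : Fin M × Fin M) :
    ∫ ω, (a + E ω p.1 p.2) * (b + E ω q.1 q.2) ∂μ = a * b + if p = q then (v : ℝ) else 0 := by
  have hp := (hE.memLp_two p.1 p.2).integrable (by norm_num)
  have hq := (hE.memLp_two q.1 q.2).integrable (by norm_num)
  have hpq : Integrable (fun ω => E ω p.1 p.2 * E ω q.1 q.2) μ :=
    (hE.memLp_two p.1 p.2).integrable_mul (hE.memLp_two q.1 q.2)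
  have h : (fun ω => (a + E ω p.1 p.2) * (b + E ω q.1 q.2))
      = fun ω => (a * b + b * E ω p.1 p.2 + a * E ω q.1 q.2) + E ω p.1 p.2 * E ω q.1 q.2 := by
    funext ω; ring
  rw [h, integral_add (by fun_prop) hpq, integral_add (by fun_prop) (by fun_prop),
    integral_add (by fun_prop) (by fun_prop), integral_const_mul, integral_const_mul,
    integral_const_mul,
    hE.integral_eq_zero, hE.integral_eq_zero, hE.integral_mul_eq]
  simp

theorem memLp_mul_apply [IsProbabilityMeasure μ] (hE : IsGaussianMatrix μ v E)
    (C P : Matrix (Fin M) (Fin M) ℝ) (i j : Fin M) :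
    MemLp (fun ω => (P * (C + E ω)) i j) 2 μ := by
  simp only [mul_apply, Matrix.add_apply]
  exact memLp_finsetSum _ fun k _ => (hE.memLp_two_add _ k j).const_mul _

theorem integrable_hsNormSq_mul [IsProbabilityMeasure μ] (hE : IsGaussianMatrix μ v E)
    (C P : Matrix (Fin M) (Fin M) ℝ) : Integrable (fun ω => hsNormSq (P * (C + E ω))) μ :=
  integrable_finsetSum _ fun i _ => integrable_finsetSum _ fun j _ =>
    (hE.memLp_mul_apply C P i j).integrable_sq

theorem integral_mul_apply_sq [IsProbabilityMeasure μ] (hE : IsGaussianMatrix μ v E)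
    (C P : Matrix (Fin M) (Fin M) ℝ) (i j : Fin M) :
    ∫ ω, (P * (C + E ω)) i j ^ 2 ∂μ = (P * C) i j ^ 2 + v * ∑ k, P i k ^ 2 := by
  have h : ∀ ω, (P * (C + E ω)) i j ^ 2 = ∑ k, ∑ l, (P i k * P i l) *
      ((C k j + E ω k j) * (C l j + E ω l j)) := by
    intro ω
    rw [mul_apply, sq, Finset.sum_mul_sum]
    exact Finset.sum_congr rfl fun k _ => Finset.sum_congr rfl fun l _ => by
      simp only [Matrix.add_apply]; ring
  have hint : ∀ k l, Integrable (fun ω => (P i k * P i l) *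
      ((C k j + E ω k j) * (C l j + E ω l j))) μ := fun k l =>
    ((hE.memLp_two_add (C k j) k j).integrable_mul (hE.memLp_two_add (C l j) l j)).const_mul _
  simp_rw [h]
  rw [integral_finsetSum _ fun k _ => integrable_finsetSum _ fun l _ => hint k l]
  simp_rw [integral_finsetSum _ fun l _ => hint _ l, integral_const_mul]
  have h2 : ∀ k l, ∫ ω, (C k j + E ω k j) * (C l j + E ω l j) ∂μ
      = C k j * C l j + if k = l then (v : ℝ) else 0 := fun k l => by
    simpa using hE.integral_add_mul_add (C k j) (C l j) (k, j) (l, j)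
  simp_rw [h2, mul_add, Finset.sum_add_distrib]
  congr 1
  · rw [mul_apply, sq, Finset.sum_mul_sum]
    exact Finset.sum_congr rfl fun k _ => Finset.sum_congr rfl fun l _ => by ring
  · simp [Finset.mul_sum, sq, mul_comm]

/-- Cross terms vanish by centering and independence. On rank-one projections the noise term is the
constant `v * M`, so the population maximizer is a maximizer for C itself. -/
theorem integral_hsNormSq_mul [IsProbabilityMeasure μ] (hE : IsGaussianMatrix μ v E)
    (C P : Matrix (Fin M) (Fin M) ℝ) :
    ∫ ω, hsNormSq (P * (C + E ω)) ∂μ = hsNormSq (P * C) + v * M * hsNormSq P := by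
  have hint := fun i j => (hE.memLp_mul_apply C P i j).integrable_sq
  simp only [hsNormSq]
  rw [integral_finsetSum _ fun k _ => integrable_finsetSum _ fun l _ => hint k l]
  simp_rw [integral_finsetSum _ fun l _ => hint _ l, hE.integral_mul_apply_sq,
    Finset.sum_add_distrib]
  congr 1
  simp [Finset.mul_sum, mul_left_comm, mul_assoc]

theorem integrable_topSingularValue_sq [IsProbabilityMeasure μ] (hE : IsGaussianMatrix μ v E)
    (hM : 0 < M) (C : Matrix (Fin M) (Fin M) ℝ) :
    Integrable (fun ω => topSingularValue (C + E ω) ^ 2) μ := by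
  have h1 := hE.integrable_hsNormSq_mul C 1
  simp only [one_mul] at h1
  refine h1.mono' ?_ (Filter.Eventually.of_forall fun ω => ?_)
  · have hc : Continuous fun x : Fin M × Fin M → ℝ =>
        topSingularValue (C + Matrix.of fun i j => x (i, j)) ^ 2 :=
      ((continuous_topSingularValue hM).comp (by fun_prop)).pow 2
    exact (hc.measurable.comp_aemeasurable hE.hasLaw_pi.aemeasurable).aestronglyMeasurable
  · rw [Real.norm_of_nonneg (sq_nonneg _)]
    exact topSingularValue_sq_le_hsNormSq hM _

theorem integral_hsNormSq_populationProj_mul [IsProbabilityMeasure μ]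
    (hE : IsGaussianMatrix μ v E) (hM : 0 < M) (C : Matrix (Fin M) (Fin M) ℝ) :
    ∫ ω, hsNormSq (populationProj μ 1 (fun ω' => C + E ω') * (C + E ω)) ∂μ
      = topSingularValue C ^ 2 + v * M := by
  have hf : (fun P : Matrix (Fin M) (Fin M) ℝ => ∫ ω, hsNormSq (P * (C + E ω)) ∂μ)
      = fun P => hsNormSq (P * C) + v * M * hsNormSq P :=
    funext fun P => hE.integral_hsNormSq_mul C P
  have hcont : Continuous (fun P : Matrix (Fin M) (Fin M) ℝ =>
      ∫ ω, hsNormSq (P * (C + E ω)) ∂μ) := by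
    rw [hf]
    have h1 := continuous_hsNormSq_mul (1 : Matrix (Fin M) (Fin M) ℝ)
    simp only [mul_one] at h1
    exact (continuous_hsNormSq_mul C).add (continuous_const.mul h1)
  obtain ⟨h1, h2⟩ := argmaxProj_spec (r := 1) hM hcont.continuousOn
  obtain ⟨P, hP, hPC⟩ := exists_orthProj_hsNormSq_mul hM C
  refine le_antisymm ?_ ?_
  · rw [hE.integral_hsNormSq_mul]
    have h3 := hsNormSq_mul_le (populationProj μ 1 fun ω' => C + E ω') C
    rw [populationProj, hsNormSq_orthProj h1] at *
    simpa using h3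
  · have h3 : ∫ ω, hsNormSq (P * (C + E ω)) ∂μ ≤ _ := h2 hP
    rw [hE.integral_hsNormSq_mul, hPC, hsNormSq_orthProj hP, Nat.cast_one, mul_one] at h3
    exact h3

/-- The accuracy of approximation in terms of the largest singular values. -/
theorem delta_eq [IsProbabilityMeasure μ] (hE : IsGaussianMatrix μ v E) (hM : 0 < M)
    (C : Matrix (Fin M) (Fin M) ℝ) :
    delta μ E C 1 = (∫ ω, topSingularValue (C + E ω) ^ 2 ∂μ) - v * M - topSingularValue C ^ 2 := by
  rw [delta, hE.integral_hsNormSq_populationProj_mul hM]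
  simp_rw [hsNormSq_empiricalProj_mul hM]
  ring

end IsGaussianMatrix

end

/-! ### Upper bound: second moment of the operator norm of pure noise -/

section

theorem lintegral_exp_linear_pi_gaussianReal {ι : Type*} [Fintype ι] (v : ℝ≥0) (a : ι → ℝ) :
    ∫⁻ x, ENNReal.ofReal (Real.exp (∑ p, a p * x p)) ∂(Measure.pi fun _ : ι => gaussianReal 0 v)
      = ENNReal.ofReal (Real.exp (v / 2 * ∑ p, a p ^ 2)) := by
  have hint : Integrable (fun x : ι → ℝ => ∏ p, Real.exp (a p * x p))
      (Measure.pi fun _ : ι => gaussianReal 0 v) :=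
    Integrable.fintype_prod (f := fun p y => Real.exp (a p * y))
      fun p => integrable_exp_mul_gaussianReal _
  simp_rw [Real.exp_sum]
  rw [← ofReal_integral_eq_lintegral_ofReal hint (Filter.Eventually.of_forall fun x => by positivity),
    integral_fintype_prod_eq_prod (fun p y => Real.exp (a p * y))]
  have h : ∀ p, ∫ y, Real.exp (a p * y) ∂(gaussianReal 0 v) = Real.exp (v / 2 * a p ^ 2) := by
    intro p
    have := congrFun (mgf_fun_id_gaussianReal (μ := 0) (v := v)) (a p)
    rw [mgf] at this
    rw [this]
    congr 1
    ring
  simp_rw [h, ← Real.exp_sum, Finset.mul_sum]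

variable {M : ℕ}

theorem abs_dotProduct_mulVec_le (A : Matrix (Fin M) (Fin M) ℝ) (x y : EuclideanSpace ℝ (Fin M)) :
    |x.ofLp ⬝ᵥ (A *ᵥ y.ofLp)| ≤ topSingularValue A * ‖x‖ * ‖y‖ := by
  have hs := topSingularValue_nonneg A
  have h1 := Finset.sum_mul_sq_le_sq_mul_sq Finset.univ x.ofLp (A *ᵥ y.ofLp)
  have h2 := mulVec_dotProduct_mulVec_le A y.ofLp
  rw [← real_norm_sq_eq_dotProduct y] at h2
  have h3 : ∑ i, x.ofLp i ^ 2 = ‖x‖ ^ 2 := (EuclideanSpace.real_norm_sq_eq x).symm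
  have h4 : ∑ i, (A *ᵥ y.ofLp) i ^ 2 = (A *ᵥ y.ofLp) ⬝ᵥ (A *ᵥ y.ofLp) :=
    Finset.sum_congr rfl fun i _ => sq _
  rw [h3, h4] at h1
  refine abs_le_of_sq_le_sq ?_ (by positivity)
  calc (x.ofLp ⬝ᵥ (A *ᵥ y.ofLp)) ^ 2 ≤ ‖x‖ ^ 2 * ((A *ᵥ y.ofLp) ⬝ᵥ (A *ᵥ y.ofLp)) := h1
    _ ≤ ‖x‖ ^ 2 * (topSingularValue A ^ 2 * ‖y‖ ^ 2) := by gcongr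
    _ = (topSingularValue A * ‖x‖ * ‖y‖) ^ 2 := by ring

/-- The bilinear form of a matrix stays comparable to its largest singular value near a pair of
singular vectors. -/
theorem exists_ball_le_bilinear (hM : 0 < M) (A : Matrix (Fin M) (Fin M) ℝ) :
    ∃ z₀ : EuclideanSpace ℝ (Fin M) × EuclideanSpace ℝ (Fin M), ‖z₀‖ ≤ 1 ∧
      ∀ z ∈ Metric.ball z₀ (1 / 4),
        topSingularValue A / 4 ≤ z.1.ofLp ⬝ᵥ (A *ᵥ z.2.ofLp) := by
  obtain ⟨u, w, hu, hw, h1, h2⟩ := exists_singular_pair hM A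
  have hs := topSingularValue_nonneg A
  set s := topSingularValue A with hsdef
  set u' : EuclideanSpace ℝ (Fin M) := WithLp.toLp 2 u with hu'
  set w' : EuclideanSpace ℝ (Fin M) := WithLp.toLp 2 w with hw'
  have hun : ‖u'‖ = 1 := by
    rw [← sq_eq_sq₀ (norm_nonneg _) zero_le_one, real_norm_sq_eq_dotProduct, hu, one_pow]
  have hwn : ‖w'‖ = 1 := by
    rw [← sq_eq_sq₀ (norm_nonneg _) zero_le_one, real_norm_sq_eq_dotProduct, hw, one_pow]
  refine ⟨(u', w'), by simp [Prod.norm_def, hun, hwn], fun z hz => ?_⟩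
  rw [mem_ball_iff_norm, Prod.norm_def, max_lt_iff] at hz
  obtain ⟨ha, hb⟩ := hz
  set a := z.1 - u' with hadef
  set b := z.2 - w' with hbdef
  have hz1 : z.1.ofLp = u + a.ofLp := by simp [hadef, hu']
  have hz2 : z.2.ofLp = w + b.ofLp := by simp [hbdef, hw']
  change ‖a‖ < 1 / 4 at ha
  change ‖b‖ < 1 / 4 at hb
  have e0 : u ⬝ᵥ (A *ᵥ w) = s := by rw [h2, dotProduct_smul, hu]; simp
  have e1 := abs_dotProduct_mulVec_le A u' b
  have e2 := abs_dotProduct_mulVec_le A a w'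
  have e3 := abs_dotProduct_mulVec_le A a b
  rw [hun] at e1
  rw [hwn] at e2
  rw [hz1, hz2, mulVec_add, add_dotProduct, dotProduct_add, dotProduct_add, e0]
  have f1 := (abs_le.1 e1).1
  have f2 := (abs_le.1 e2).1
  have f3 := (abs_le.1 e3).1
  change _ ≤ u ⬝ᵥ _ at f1
  change _ ≤ a.ofLp ⬝ᵥ A *ᵥ w at f2
  rw [← hsdef] at f1 f2 f3
  -- The perturbation costs at most s/4 + s/4 + s/16, leaving 7s/16 ≥ s/4.
  have g1 : s * ‖b‖ ≤ s * (1 / 4) := by gcongr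
  have g2 : s * ‖a‖ ≤ s * (1 / 4) := by gcongr
  have g3 : s * ‖a‖ * ‖b‖ ≤ s * (1 / 4) * (1 / 4) := by gcongr
  linarith

/-- Exponential moments of the operator norm of a Gaussian matrix, by comparison of volumes. -/
theorem lintegral_exp_topSingularValue_le (hM : 0 < M) (v : ℝ≥0) {β : ℝ} (hβ : 0 ≤ β) :
    ∫⁻ x : Fin M × Fin M → ℝ,
        ENNReal.ofReal (Real.exp (β * (topSingularValue (Matrix.of fun i j => x (i, j)) / 4)))
        ∂(Measure.pi fun _ => gaussianReal 0 v)
      ≤ ENNReal.ofReal (25 ^ M * Real.exp (2 * β ^ 2 * v)) := by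
  have : Nonempty (Fin M) := ⟨⟨0, hM⟩⟩
  set γ : Measure (Fin M × Fin M → ℝ) := Measure.pi fun _ => gaussianReal 0 v
  set ν : Measure (EuclideanSpace ℝ (Fin M) × EuclideanSpace ℝ (Fin M)) :=
    (volume : Measure (EuclideanSpace ℝ (Fin M))).prod volume
  set V := ν (Metric.ball 0 (1 / 4)) with hV
  have hfin : Module.finrank ℝ (EuclideanSpace ℝ (Fin M) × EuclideanSpace ℝ (Fin M)) = 2 * M := by
    rw [Module.finrank_prod, finrank_euclideanSpace]; simp; ring
  have hball : ∀ z : EuclideanSpace ℝ (Fin M) × EuclideanSpace ℝ (Fin M), ν (Metric.ball z (1 / 4)) = V := fun z => by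
    rw [hV, Measure.addHaar_ball_center ν z]
  have hVpos : V ≠ 0 := (Metric.measure_ball_pos ν 0 (by norm_num)).ne'
  have hVtop : V ≠ ⊤ := measure_ball_lt_top.ne
  -- The radii have ratio 5 and the dimension is 2 M, whence 5 ^ (2 M) = 25 ^ M.
  have hbig : ν (Metric.ball 0 (5 / 4)) = ENNReal.ofReal (25 ^ M) * V := by
    rw [hV, Measure.addHaar_ball ν 0 (by norm_num : (0 : ℝ) ≤ 5 / 4),
      Measure.addHaar_ball ν 0 (by norm_num : (0 : ℝ) ≤ 1 / 4), ← mul_assoc,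
      ← ENNReal.ofReal_mul (by positivity), hfin]
    congr 2
    rw [pow_mul, pow_mul, ← mul_pow]
    norm_num
  set φ : (Fin M × Fin M → ℝ) → EuclideanSpace ℝ (Fin M) × EuclideanSpace ℝ (Fin M) → ENNReal := fun x z =>
    ENNReal.ofReal (Real.exp (β * (z.1.ofLp ⬝ᵥ ((Matrix.of fun i j => x (i, j)) *ᵥ z.2.ofLp))))
    with hφ
  have hmeas : Measurable (Function.uncurry φ) := by
    have : Continuous fun q : (Fin M × Fin M → ℝ) × EuclideanSpace ℝ (Fin M) × EuclideanSpace ℝ (Fin M) =>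
        Real.exp (β * (q.2.1.ofLp ⬝ᵥ ((Matrix.of fun i j => q.1 (i, j)) *ᵥ q.2.2.ofLp))) := by
      simp only [dotProduct, mulVec, Matrix.of_apply]
      fun_prop
    exact this.measurable.ennreal_ofReal
  -- The good ball moves with x, but its center has norm at most 1, so it stays inside the fixed
  -- ball of radius 5/4; all such balls have volume V.
  have hlow : ∀ x : Fin M × Fin M → ℝ,
      ENNReal.ofReal (Real.exp (β * (topSingularValue (Matrix.of fun i j => x (i, j)) / 4))) * V
        ≤ ∫⁻ z in Metric.ball 0 (5 / 4), φ x z ∂ν := by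
    intro x
    obtain ⟨z₀, hz₀, hz⟩ := exists_ball_le_bilinear hM (Matrix.of fun i j => x (i, j))
    rw [← hball z₀, ← setLIntegral_const]
    refine (setLIntegral_mono' measurableSet_ball fun z hzz => ?_).trans
      (lintegral_mono_set (Metric.ball_subset_ball' ?_))
    · refine ENNReal.ofReal_le_ofReal (Real.exp_le_exp.2 ?_)
      exact mul_le_mul_of_nonneg_left (hz z hzz) hβ
    · rw [dist_zero_right]; linarith
  have hupp : ∀ z ∈ Metric.ball (0 : EuclideanSpace ℝ (Fin M) × EuclideanSpace ℝ (Fin M)) (5 / 4),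
      ∫⁻ x, φ x z ∂γ ≤ ENNReal.ofReal (Real.exp (2 * β ^ 2 * v)) := by
    intro z hz
    rw [mem_ball_zero_iff, Prod.norm_def, max_lt_iff] at hz
    have h1 : ∀ x, φ x z = ENNReal.ofReal (Real.exp
        (∑ p : Fin M × Fin M, (β * (z.1.ofLp p.1 * z.2.ofLp p.2)) * x p)) := by
      intro x
      simp only [hφ, dotProduct, mulVec, Fintype.sum_prod_type, Matrix.of_apply, Finset.mul_sum]
      congr 2
      exact Finset.sum_congr rfl fun i _ => Finset.sum_congr rfl fun j _ => by ring
    simp_rw [h1]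
    rw [lintegral_exp_linear_pi_gaussianReal]
    refine ENNReal.ofReal_le_ofReal (Real.exp_le_exp.2 ?_)
    have h2 : ∑ p : Fin M × Fin M, (β * (z.1.ofLp p.1 * z.2.ofLp p.2)) ^ 2
        = β ^ 2 * (‖z.1‖ ^ 2 * ‖z.2‖ ^ 2) := by
      rw [EuclideanSpace.real_norm_sq_eq, EuclideanSpace.real_norm_sq_eq, Fintype.sum_prod_type,
        Finset.sum_mul_sum, Finset.mul_sum]
      simp_rw [Finset.mul_sum, mul_pow]
    rw [h2]
    have h3 : ‖z.1‖ ^ 2 * ‖z.2‖ ^ 2 ≤ 2 * 2 := by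
      have a1 : ‖z.1‖ ^ 2 ≤ 2 := by nlinarith [norm_nonneg z.1]
      have a2 : ‖z.2‖ ^ 2 ≤ 2 := by nlinarith [norm_nonneg z.2]
      gcongr
    calc (v : ℝ) / 2 * (β ^ 2 * (‖z.1‖ ^ 2 * ‖z.2‖ ^ 2)) ≤ v / 2 * (β ^ 2 * (2 * 2)) := by gcongr
      _ = 2 * β ^ 2 * v := by ring
  have hmain : (∫⁻ x : Fin M × Fin M → ℝ,
        ENNReal.ofReal (Real.exp (β * (topSingularValue (Matrix.of fun i j => x (i, j)) / 4))) ∂γ) * V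
      ≤ ENNReal.ofReal (25 ^ M * Real.exp (2 * β ^ 2 * v)) * V := by
    calc _ = ∫⁻ x : Fin M × Fin M → ℝ,
        ENNReal.ofReal (Real.exp (β * (topSingularValue (Matrix.of fun i j => x (i, j)) / 4))) * V
          ∂γ := (lintegral_mul_const' _ _ hVtop).symm
      _ ≤ ∫⁻ x, ∫⁻ z in Metric.ball 0 (5 / 4), φ x z ∂ν ∂γ := lintegral_mono hlow
      _ = ∫⁻ z in Metric.ball 0 (5 / 4), ∫⁻ x, φ x z ∂γ ∂ν :=
        lintegral_lintegral_swap hmeas.aemeasurable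
      _ ≤ ∫⁻ z in Metric.ball 0 (5 / 4), ENNReal.ofReal (Real.exp (2 * β ^ 2 * v)) ∂ν :=
        setLIntegral_mono' measurableSet_ball hupp
      _ = _ := by
        rw [setLIntegral_const, hbig, ENNReal.ofReal_mul (by positivity)]
        ring
  exact (ENNReal.mul_le_mul_iff_left hVpos hVtop).1 hmain

/-- For x = a + t with t ≥ 0, use x² ≤ 2a² + 2t² and t²/2 ≤ exp t. -/
theorem sq_le_two_mul_sq_add_exp {x a : ℝ} (hx : 0 ≤ x) (ha : 0 ≤ a) :
    x ^ 2 ≤ 2 * a ^ 2 + 4 * Real.exp (x - a) := by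
  have hpos := Real.exp_pos (x - a)
  rcases le_total x a with h | h
  · nlinarith
  · have := Real.quadratic_le_exp_of_nonneg (sub_nonneg.2 h)
    nlinarith [sq_nonneg (x - a - a)]

variable {Ω : Type*} [MeasurableSpace Ω] {μ : Measure Ω} {v : ℝ≥0}
  {E : Ω → Matrix (Fin M) (Fin M) ℝ}

/-- The second moment of the operator norm of a Gaussian matrix is of order `v * M`. -/
theorem IsGaussianMatrix.integral_topSingularValue_sq_le [IsProbabilityMeasure μ]
    (hE : IsGaussianMatrix μ v E) (hM : 0 < M) (hv : 0 < v) :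
    ∫ ω, topSingularValue (E ω) ^ 2 ∂μ ≤ 1216 * (v * M) := by
  set γ : Measure (Fin M × Fin M → ℝ) := Measure.pi fun _ => gaussianReal 0 v
  set S : (Fin M × Fin M → ℝ) → ℝ := fun x => topSingularValue (Matrix.of fun i j => x (i, j))
  have hS : Continuous S := (continuous_topSingularValue hM).comp (by fun_prop)
  have hS0 : ∀ x, 0 ≤ S x := fun x => topSingularValue_nonneg _
  have hM1 : (1 : ℝ) ≤ M := by exact_mod_cast hM
  have hv' : (0 : ℝ) < v := by exact_mod_cast hv
  have htrans : ∫ ω, topSingularValue (E ω) ^ 2 ∂μ = ∫ x, S x ^ 2 ∂γ :=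
    hE.hasLaw_pi.integral_comp (hS.pow 2).aestronglyMeasurable
  rw [htrans]
  -- This β makes β² v = M, so the Gaussian factor exp (2 M) is of the same exponential order as 25
  -- ^ M ≤ exp (4 M). The threshold a = 6 M below cancels their product.
  set β : ℝ := Real.sqrt (M / v) with hβ
  have hβ2 : β ^ 2 = M / v := Real.sq_sqrt (by positivity)
  set X : (Fin M × Fin M → ℝ) → ℝ := fun x => β * (S x / 4)
  have hX : Continuous X := continuous_const.mul (hS.div_const 4)
  have hX0 : ∀ x, 0 ≤ X x := fun x =>
    mul_nonneg (Real.sqrt_nonneg _) (div_nonneg (hS0 x) (by norm_num))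
  have hle : ∫⁻ x, ENNReal.ofReal (Real.exp (X x)) ∂γ ≤ ENNReal.ofReal (Real.exp (6 * M)) := by
    refine (lintegral_exp_topSingularValue_le hM v (Real.sqrt_nonneg _)).trans
      (ENNReal.ofReal_le_ofReal ?_)
    rw [hβ2]
    have h25 : (25 : ℝ) ≤ Real.exp 4 := by
      have h1 : (2.7 : ℝ) ≤ Real.exp 1 := by linarith [Real.exp_one_gt_d9]
      calc (25 : ℝ) ≤ 2.7 ^ 4 := by norm_num
        _ ≤ Real.exp 1 ^ 4 := by gcongr
        _ = Real.exp 4 := by rw [← Real.exp_nat_mul]; norm_num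
    calc 25 ^ M * Real.exp (2 * (M / v) * v) ≤ Real.exp 4 ^ M * Real.exp (2 * M) := by
          have : 2 * ((M : ℝ) / v) * v = 2 * M := by field_simp
          rw [this]
          gcongr
      _ = Real.exp (6 * M) := by
          rw [← Real.exp_nat_mul, ← Real.exp_add]; ring_nf
  have hint : Integrable (fun x => Real.exp (X x)) γ := by
    refine ⟨(Real.continuous_exp.comp hX).aestronglyMeasurable, ?_⟩
    rw [hasFiniteIntegral_iff_ofReal (Filter.Eventually.of_forall fun x => (Real.exp_pos _).le)]
    exact hle.trans_lt ENNReal.ofReal_lt_top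
  have hexp : ∫ x, Real.exp (X x) ∂γ ≤ Real.exp (6 * M) := by
    rw [integral_eq_lintegral_of_nonneg_ae (Filter.Eventually.of_forall fun x => (Real.exp_pos _).le)
      (Real.continuous_exp.comp hX).aestronglyMeasurable]
    exact ENNReal.toReal_le_of_le_ofReal (Real.exp_pos _).le hle
  have hpt : ∀ x, S x ^ 2 ≤ 16 * (v / M) * (72 * M ^ 2)
      + 16 * (v / M) * (4 * Real.exp (-(6 * M))) * Real.exp (X x) := by
    intro x
    have h1 := sq_le_two_mul_sq_add_exp (hX0 x) (by positivity : (0 : ℝ) ≤ 6 * M)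
    have h2 : S x ^ 2 = 16 * (v / M) * X x ^ 2 := by
      change S x ^ 2 = 16 * (v / M) * (β * (S x / 4)) ^ 2
      rw [mul_pow, hβ2]
      field_simp
      norm_num
    rw [h2]
    have h3 : (0 : ℝ) ≤ 16 * (v / M) := by positivity
    calc 16 * ((v : ℝ) / M) * X x ^ 2
        ≤ 16 * (v / M) * (2 * (6 * M) ^ 2 + 4 * Real.exp (X x - 6 * M)) := by gcongr
      _ = _ := by rw [sub_eq_add_neg, Real.exp_add]; ring
  calc ∫ x, S x ^ 2 ∂γ ≤ ∫ x, (16 * (v / M) * (72 * M ^ 2)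
      + 16 * (v / M) * (4 * Real.exp (-(6 * M))) * Real.exp (X x)) ∂γ :=
        integral_mono_of_nonneg (Filter.Eventually.of_forall fun x => sq_nonneg _)
          ((integrable_const _).add (hint.const_mul _)) (Filter.Eventually.of_forall hpt)
    _ = 16 * (v / M) * (72 * M ^ 2)
      + 16 * (v / M) * (4 * Real.exp (-(6 * M))) * ∫ x, Real.exp (X x) ∂γ := by
        rw [integral_add (integrable_const _) (hint.const_mul _), integral_const,
          integral_const_mul]
        simp
    _ ≤ 16 * (v / M) * (72 * M ^ 2)
      + 16 * (v / M) * (4 * Real.exp (-(6 * M))) * Real.exp (6 * M) := by gcongr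
    _ = 16 * (v / M) * (72 * M ^ 2 + 4) := by
        rw [mul_assoc _ _ (Real.exp (6 * M)), mul_assoc 4, ← Real.exp_add]; simp; ring
    _ ≤ 16 * (v / M) * (76 * M ^ 2) := by
        gcongr
        nlinarith
    _ = 1216 * (v * M) := by field_simp; ring

end

/-! ### Lower bound: a test vector built from one row of the noise -/

section

theorem exists_orthogonal_row {M : ℕ} (k : Fin M) {u : Fin M → ℝ} (hu : u ⬝ᵥ u = 1) :
    ∃ U : Matrix (Fin M) (Fin M) ℝ, U * Uᵀ = 1 ∧ U k = u := by
  have hun : ‖(WithLp.toLp 2 u : EuclideanSpace ℝ (Fin M))‖ = 1 := by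
    rw [← sq_eq_sq₀ (norm_nonneg _) zero_le_one, real_norm_sq_eq_dotProduct, hu, one_pow]
  have horth : Orthonormal ℝ (({k} : Set (Fin M)).domRestrict
      fun _ : Fin M => (WithLp.toLp 2 u : EuclideanSpace ℝ (Fin M))) :=
    ⟨fun _ => hun, fun i j hij => (hij (Subsingleton.elim i j)).elim⟩
  obtain ⟨b, hb⟩ := horth.exists_orthonormalBasis_extension_of_card_eq (by simp)
  refine ⟨Matrix.of fun i => (b i).ofLp, ?_, ?_⟩
  · ext i j
    have h := orthonormal_iff_ite.1 b.orthonormal j i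
    rw [EuclideanSpace.inner_eq_star_dotProduct, star_trivial] at h
    rw [mul_apply, one_apply]
    simp only [transpose_apply, of_apply, eq_comm (a := i)]
    exact h
  · change (b k).ofLp = u
    rw [hb k rfl]

theorem orthogonal_mulVec_dotProduct_le {M : ℕ} {U V : Matrix (Fin M) (Fin M) ℝ}
    (hU : Uᵀ * U = 1) (hV : Vᵀ * V = 1) (X : Matrix (Fin M) (Fin M) ℝ) (y : Fin M → ℝ) :
    ((U * X * V) *ᵥ y) ⬝ᵥ ((U * X * V) *ᵥ y) ≤ topSingularValue X ^ 2 * (y ⬝ᵥ y) := by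
  have hiso : ∀ {O : Matrix (Fin M) (Fin M) ℝ}, Oᵀ * O = 1 → ∀ x : Fin M → ℝ,
      (O *ᵥ x) ⬝ᵥ (O *ᵥ x) = x ⬝ᵥ x := fun hO x => by
    rw [dotProduct_mulVec, ← mulVec_transpose, mulVec_mulVec, hO, one_mulVec]
  rw [← mulVec_mulVec, ← mulVec_mulVec, hiso hU, ← hiso hV y]
  exact mulVec_dotProduct_mulVec_le X _

/-- The mean absolute value of a standard Gaussian variable. -/
def gaussianAbsMean : ℝ := ∫ x, |x| ∂(gaussianReal 0 1)

/-- A zero mean of |x| would force x = 0 almost surely, contradicting variance 1. -/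
theorem gaussianAbsMean_pos : 0 < gaussianAbsMean := by
  have hint : Integrable (fun x : ℝ => |x|) (gaussianReal 0 1) :=
    ((memLp_id_gaussianReal 1).integrable (by simp)).abs
  refine lt_of_le_of_ne (integral_nonneg fun x => abs_nonneg x) fun h => ?_
  have h0 : (fun x : ℝ => |x|) =ᵐ[gaussianReal 0 1] 0 :=
    (integral_eq_zero_iff_of_nonneg (fun x => abs_nonneg x) hint).1 h.symm
  have h1 : (id : ℝ → ℝ) =ᵐ[gaussianReal 0 1] fun _ => (0 : ℝ) :=
    h0.mono fun x hx => abs_eq_zero.1 hx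
  have h2 := variance_congr h1
  rw [variance_id_gaussianReal] at h2
  simp [variance_eq_integral] at h2

theorem integral_abs_gaussianReal (v : ℝ≥0) :
    ∫ x, |x| ∂(gaussianReal 0 v) = Real.sqrt v * gaussianAbsMean := by
  have h := gaussianReal_map_const_mul (μ := 0) (v := 1) (Real.sqrt v)
  have hv : NNReal.mk (Real.sqrt v ^ 2) (sq_nonneg _) * 1 = v := by
    rw [mul_one]; exact NNReal.eq (Real.sq_sqrt v.2)
  rw [mul_zero, hv] at h
  rw [← h, integral_map (by fun_prop) (by fun_prop), gaussianAbsMean, ← integral_const_mul]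
  simp_rw [abs_mul, abs_of_nonneg (Real.sqrt_nonneg _)]

/-- The sign of a real number, with the value `1` at `0`. -/
def sgn (x : ℝ) : ℝ := if 0 ≤ x then 1 else -1

theorem mul_sgn (x : ℝ) : x * sgn x = |x| := by
  unfold sgn
  split_ifs with h
  · rw [mul_one, abs_of_nonneg h]
  · rw [mul_neg, mul_one, abs_of_neg (not_le.1 h)]

theorem sgn_sq (x : ℝ) : sgn x ^ 2 = 1 := by
  unfold sgn
  split_ifs <;> norm_num

theorem measurable_sgn : Measurable sgn :=
  Measurable.ite measurableSet_Ici measurable_const measurable_const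

section

variable {M : ℕ} {Ω : Type*} [MeasurableSpace Ω] {μ : Measure Ω} {v : ℝ≥0}
  {E : Ω → Matrix (Fin M) (Fin M) ℝ}

namespace IsGaussianMatrix

theorem integral_abs (hE : IsGaussianMatrix μ v E) (i j : Fin M) :
    ∫ ω, |E ω i j| ∂μ = Real.sqrt v * gaussianAbsMean := by
  rw [← integral_abs_gaussianReal]
  exact (hE.hasLaw i j).integral_comp (f := fun x : ℝ => |x|) (by fun_prop)

theorem memLp_add_mul_comp [IsProbabilityMeasure μ] (hE : IsGaussianMatrix μ v E) (c : ℝ)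
    (i j k l : Fin M) {f : ℝ → ℝ} (hf : Measurable f) {B : ℝ} (hB : ∀ x, |f x| ≤ B) :
    MemLp (fun ω => (c + E ω i j) * f (E ω k l)) 2 μ := by
  refine ((hE.memLp_two_add c i j).const_mul B).of_le
    ((hE.memLp_two_add c i j).aestronglyMeasurable.mul
      (hf.comp_aemeasurable (hE.aemeasurable k l)).aestronglyMeasurable)
    (Filter.Eventually.of_forall fun ω => ?_)
  rw [norm_mul, norm_mul, mul_comm]
  gcongr
  exact (hB _).trans (le_abs_self B)

/-- Testing a row of a Gaussian matrix against a random vector that depends on another row only: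
the noise contributes `v` times the squared length of the vector. -/
theorem integral_sq_row_sum_ge [IsProbabilityMeasure μ] (hE : IsGaussianMatrix μ v E)
    (c : Fin M → ℝ) {i k : Fin M} (hik : i ≠ k) {W : Fin M → ℝ → ℝ} (hW : ∀ j, Measurable (W j))
    {B : ℝ} (hB : ∀ j x, |W j x| ≤ B) (hunit : ∀ x : Fin M → ℝ, ∑ j, W j (x j) ^ 2 = 1) :
    (v : ℝ) ≤ ∫ ω, (∑ j, (c j + E ω i j) * W j (E ω k j)) ^ 2 ∂μ := by
  have hWm : ∀ j, AEStronglyMeasurable (fun ω => W j (E ω k j)) μ := fun j =>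
    ((hW j).comp_aemeasurable (hE.aemeasurable k j)).aestronglyMeasurable
  have hWL : ∀ j, MemLp (fun ω => W j (E ω k j)) 2 μ := fun j =>
    MemLp.of_bound (hWm j) B (Filter.Eventually.of_forall fun ω => hB j _)
  have hWW : ∀ j l, Integrable (fun ω => W j (E ω k j) * W l (E ω k l)) μ := fun j l =>
    (hWL j).integrable_mul (hWL l)
  have hterm : ∀ j, MemLp (fun ω => (c j + E ω i j) * W j (E ω k j)) 2 μ := fun j =>
    hE.memLp_add_mul_comp (c j) i j k j (hW j) (hB j)
  have hint : ∀ j l, Integrable (fun ω => ((c j + E ω i j) * W j (E ω k j)) *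
      ((c l + E ω i l) * W l (E ω k l))) μ := fun j l => (hterm j).integrable_mul (hterm l)
  -- Rows i and k are independent, so the expectation factorizes.
  have hind : ∀ j l, ∫ ω, ((c j + E ω i j) * W j (E ω k j)) * ((c l + E ω i l) * W l (E ω k l)) ∂μ
      = (c j * c l + if j = l then (v : ℝ) else 0) * ∫ ω, W j (E ω k j) * W l (E ω k l) ∂μ := by
    intro j l
    have h1 := hE.indep.indepFun_prodMk_prodMk₀ (fun p => hE.aemeasurable p.1 p.2)
      (i, j) (i, l) (k, j) (k, l) (by simp [hik]) (by simp [hik]) (by simp [hik]) (by simp [hik])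
    have h2 : IndepFun (fun ω => (c j + E ω i j) * (c l + E ω i l))
        (fun ω => W j (E ω k j) * W l (E ω k l)) μ :=
      h1.comp (φ := fun q : ℝ × ℝ => (c j + q.1) * (c l + q.2))
        (ψ := fun q : ℝ × ℝ => W j q.1 * W l q.2) (by fun_prop)
        (((hW j).comp measurable_fst).mul ((hW l).comp measurable_snd))
    have h3 := h2.integral_fun_mul_eq_mul_integral
      ((hE.memLp_two_add (c j) i j).aestronglyMeasurable.mul
        (hE.memLp_two_add (c l) i l).aestronglyMeasurable) ((hWm j).mul (hWm l))
    have h4 := hE.integral_add_mul_add (c j) (c l) (i, j) (i, l)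
    simp only [Prod.mk.injEq, true_and] at h4
    rw [← h4, ← h3]
    refine integral_congr_ae (Filter.Eventually.of_forall fun ω => ?_)
    ring
  have hsq : ∀ ω, (∑ j, (c j + E ω i j) * W j (E ω k j)) ^ 2
      = ∑ j, ∑ l, ((c j + E ω i j) * W j (E ω k j)) * ((c l + E ω i l) * W l (E ω k l)) :=
    fun ω => by rw [sq, Finset.sum_mul_sum]
  simp_rw [hsq]
  rw [integral_finsetSum _ fun j _ => integrable_finsetSum _ fun l _ => hint j l]
  simp_rw [integral_finsetSum _ fun l _ => hint _ l, hind, add_mul, Finset.sum_add_distrib]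
  -- The contribution of the deterministic row is the second moment of ⟨c, W⟩, hence nonnegative;
  -- only the diagonal noise terms are kept.
  have hA : 0 ≤ ∑ j, ∑ l, c j * c l * ∫ ω, W j (E ω k j) * W l (E ω k l) ∂μ := by
    have : ∑ j, ∑ l, c j * c l * ∫ ω, W j (E ω k j) * W l (E ω k l) ∂μ
        = ∫ ω, (∑ j, c j * W j (E ω k j)) ^ 2 ∂μ := by
      have h5 : ∀ ω, (∑ j, c j * W j (E ω k j)) ^ 2
          = ∑ j, ∑ l, c j * c l * (W j (E ω k j) * W l (E ω k l)) := fun ω => by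
        rw [sq, Finset.sum_mul_sum]
        exact Finset.sum_congr rfl fun j _ => Finset.sum_congr rfl fun l _ => by ring
      simp_rw [h5]
      rw [integral_finsetSum _ fun j _ => integrable_finsetSum _ fun l _ => (hWW j l).const_mul _]
      simp_rw [integral_finsetSum _ fun l _ => (hWW _ l).const_mul _, integral_const_mul]
    rw [this]
    exact integral_nonneg fun ω => sq_nonneg _
  have hD : ∑ j, ∑ l, (if j = l then (v : ℝ) else 0) * ∫ ω, W j (E ω k j) * W l (E ω k l) ∂μ
      = v := by
    simp only [ite_mul, zero_mul, Finset.sum_ite_eq, Finset.mem_univ, if_true]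
    rw [← Finset.mul_sum, ← integral_finsetSum _ fun j _ => hWW j j]
    simp_rw [← sq, hunit]
    simp
  rw [hD]
  linarith

end IsGaussianMatrix

end

section

variable {d : ℕ} {Ω : Type*} [MeasurableSpace Ω] {μ : Measure Ω} {v : ℝ≥0}
  {E : Ω → Matrix (Fin (d + 1)) (Fin (d + 1)) ℝ}

namespace IsGaussianMatrix

/-- Row 0 pairs with the signs of its own entries and thus gains mean absolute values; reusing its
noise costs nothing in the other rows, which are independent of it. -/
theorem exists_test_vector [IsProbabilityMeasure μ] (hE : IsGaussianMatrix μ v E) (hd : 0 < d)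
    (hv : 0 < v) {C : Matrix (Fin (d + 1)) (Fin (d + 1)) ℝ} {s : ℝ}
    (hC : C 0 = Pi.single 0 s) :
    ∃ w : Ω → Fin (d + 1) → ℝ, (∀ ω, w ω ⬝ᵥ w ω = 1) ∧
      Integrable (fun ω => ((C + E ω) *ᵥ w ω) ⬝ᵥ ((C + E ω) *ᵥ w ω)) μ ∧
      s ^ 2 + d * (gaussianAbsMean ^ 2 * v) + d * v
        ≤ ∫ ω, ((C + E ω) *ᵥ w ω) ⬝ᵥ ((C + E ω) *ᵥ w ω) ∂μ := by
  have hd' : (0 : ℝ) < d := by exact_mod_cast hd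
  have hv' : (0 : ℝ) < v := by exact_mod_cast hv
  have hκ := gaussianAbsMean_pos
  set κ := gaussianAbsMean with hκdef
  set a : ℝ := Real.sqrt d * (Real.sqrt v * κ) with ha
  have ha2 : a ^ 2 = d * (κ ^ 2 * v) := by
    rw [ha, mul_pow, mul_pow, Real.sq_sqrt hd'.le, Real.sq_sqrt hv'.le]; ring
  set R : ℝ := Real.sqrt (s ^ 2 + a ^ 2) with hR
  have hR2 : R ^ 2 = s ^ 2 + a ^ 2 := Real.sq_sqrt (by positivity)
  have hRpos : 0 < R := Real.sqrt_pos.2 (by rw [ha2]; positivity)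
  set b : ℝ := a / R / Real.sqrt d with hb
  -- The weights s/R and a/R maximize the mean response of row 0: the first coordinate offers s, and
  -- the unit vector of d equal-weight signs offers √d · √v · κ = a. Their optimum is R = √(s² +
  -- a²). Since `sgn` never vanishes, W has unit length for every outcome.
  set W : Fin (d + 1) → ℝ → ℝ := Fin.cons (fun _ => s / R) (fun _ x => b * sgn x) with hWdef
  have hW : ∀ j, Measurable (W j) := by
    intro j
    refine Fin.cases ?_ (fun j => ?_) j
    · exact measurable_const
    · exact measurable_sgn.const_mul b
  have hB : ∀ j x, |W j x| ≤ |s / R| + |b| := by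
    intro j x
    refine Fin.cases ?_ (fun j => ?_) j
    · exact le_add_of_nonneg_right (abs_nonneg b)
    · change |b * sgn x| ≤ _
      have : |sgn x| = 1 := by unfold sgn; split_ifs <;> simp
      rw [abs_mul, this, mul_one]
      exact le_add_of_nonneg_left (abs_nonneg _)
  have hbd : d * b ^ 2 = (a / R) ^ 2 := by
    rw [hb, div_pow _ (Real.sqrt d), Real.sq_sqrt hd'.le]; field_simp
  have hunit : ∀ x : Fin (d + 1) → ℝ, ∑ j, W j (x j) ^ 2 = 1 := by
    intro x
    rw [Fin.sum_univ_succ]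
    simp only [hWdef, Fin.cons_zero, Fin.cons_succ, mul_pow, sgn_sq, mul_one, Finset.sum_const,
      Finset.card_univ, Fintype.card_fin, nsmul_eq_mul]
    rw [hbd, div_pow, div_pow, ← add_div, ← hR2, div_self (by positivity)]
  have hexp : ∀ ω, ((C + E ω) *ᵥ fun j => W j (E ω 0 j)) ⬝ᵥ ((C + E ω) *ᵥ fun j => W j (E ω 0 j))
      = ∑ i, (∑ j, (C i j + E ω i j) * W j (E ω 0 j)) ^ 2 := fun ω => by
    simp only [dotProduct, mulVec, Matrix.add_apply, ← sq]
  have hL : ∀ i, MemLp (fun ω => ∑ j, (C i j + E ω i j) * W j (E ω 0 j)) 2 μ := fun i =>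
    memLp_finsetSum _ fun j _ => hE.memLp_add_mul_comp (C i j) i j 0 j (hW j) (hB j)
  refine ⟨fun ω j => W j (E ω 0 j), fun ω => ?_, ?_, ?_⟩
  · rw [← hunit fun j => E ω 0 j]
    exact Finset.sum_congr rfl fun j _ => (sq _).symm
  · simp_rw [hexp]
    exact integrable_finsetSum _ fun i _ => (hL i).integrable_sq
  · simp_rw [hexp]
    rw [integral_finsetSum _ fun i _ => (hL i).integrable_sq, Fin.sum_univ_succ]
    have hrest : (d : ℝ) * v
        ≤ ∑ i : Fin d, ∫ ω, (∑ j, (C i.succ j + E ω i.succ j) * W j (E ω 0 j)) ^ 2 ∂μ := by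
      calc (d : ℝ) * v = ∑ _i : Fin d, (v : ℝ) := by simp
        _ ≤ _ := Finset.sum_le_sum fun i _ =>
          hE.integral_sq_row_sum_ge (C i.succ) (Fin.succ_ne_zero i) hW hB hunit
    have hmean : ∫ ω, ∑ j, (C 0 j + E ω 0 j) * W j (E ω 0 j) ∂μ = R := by
      have h1 : ∀ ω, ∑ j, (C 0 j + E ω 0 j) * W j (E ω 0 j)
          = (s + E ω 0 0) * (s / R) + ∑ j : Fin d, b * |E ω 0 j.succ| := by
        intro ω
        rw [Fin.sum_univ_succ, hC, Pi.single_eq_same]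
        refine congrArg ((s + E ω 0 0) * (s / R) + ·) (Finset.sum_congr rfl fun j _ => ?_)
        rw [← mul_sgn]
        simp only [hWdef, Fin.cons_succ, Pi.single_eq_of_ne (Fin.succ_ne_zero j)]
        ring
      have hi : ∀ j, Integrable (fun ω => E ω 0 j) μ := fun j =>
        (hE.memLp_two 0 j).integrable (by norm_num)
      have hi0 : Integrable (fun ω => (s + E ω 0 0) * (s / R)) μ :=
        ((integrable_const s).add (hi 0)).mul_const _
      have hij : ∀ j : Fin d, Integrable (fun ω => b * |E ω 0 j.succ|) μ := fun j =>
        (hi j.succ).abs.const_mul b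
      simp_rw [h1]
      rw [integral_add hi0 (integrable_finsetSum _ fun j _ => hij j),
        integral_finsetSum _ fun j _ => hij j, integral_mul_const,
        integral_add (integrable_const s) (hi 0), hE.integral_eq_zero]
      simp_rw [integral_const_mul, hE.integral_abs]
      simp only [integral_const, probReal_univ, smul_eq_mul, one_mul, add_zero, Finset.sum_const,
        Finset.card_univ, Fintype.card_fin, nsmul_eq_mul]
      have h2 : (d : ℝ) * (b * (Real.sqrt v * gaussianAbsMean)) = a * (a / R) := by
        have h3 : (d : ℝ) = Real.sqrt d * Real.sqrt d := (Real.mul_self_sqrt hd'.le).symm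
        have h4 : Real.sqrt d * b = a / R := by
          rw [hb]; field_simp
        calc (d : ℝ) * (b * (Real.sqrt v * gaussianAbsMean))
            = (Real.sqrt d * (Real.sqrt v * κ)) * (Real.sqrt d * b) := by
              conv_lhs => rw [h3]
              ring
          _ = a * (a / R) := by rw [h4]
      rw [h2]
      field_simp
      rw [hR2]
    -- The second moment is at least the squared mean, as the variance is nonnegative.
    have hfirst : R ^ 2 ≤ ∫ ω, (∑ j, (C 0 j + E ω 0 j) * W j (E ω 0 j)) ^ 2 ∂μ := by
      have h1 := variance_eq_sub (hL 0)
      have h2 := variance_nonneg (fun ω => ∑ j, (C 0 j + E ω 0 j) * W j (E ω 0 j)) μ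
      rw [h1, hmean] at h2
      simpa using h2
    rw [hR2, ha2] at hfirst
    linarith

/-- Additive noise increases the expected square of the largest singular value. -/
theorem integral_topSingularValue_sq_ge [IsProbabilityMeasure μ] (hE : IsGaussianMatrix μ v E)
    (hd : 0 < d) (hv : 0 < v) (C : Matrix (Fin (d + 1)) (Fin (d + 1)) ℝ) :
    topSingularValue C ^ 2 + d * (gaussianAbsMean ^ 2 * v) + d * v
      ≤ ∫ ω, topSingularValue (C + E ω) ^ 2 ∂μ := by
  obtain ⟨u, w, hu, hw, h1, -⟩ := exists_singular_pair (Nat.succ_pos d) C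
  obtain ⟨U, hU, hU0⟩ := exists_orthogonal_row 0 hu
  obtain ⟨V, hV, hV0⟩ := exists_orthogonal_row 0 hw
  have hU' : Uᵀ * U = 1 := mul_eq_one_comm.1 hU
  have hV' : Vᵀᵀ * Vᵀ = 1 := by rw [transpose_transpose]; exact hV
  -- Row 0 of U C is uᵀC = s wᵀ, and w is row 0 of the orthogonal V. Nothing is needed about the
  -- other rows.
  have hC : (U * C * Vᵀ) 0 = Pi.single 0 (topSingularValue C) := by
    have h2 : (U * C) 0 = topSingularValue C • w := by
      rw [← h1, mulVec_transpose, ← hU0]; rfl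
    funext j
    have h3 : (U * C * Vᵀ) 0 j = ((U * C) 0) ⬝ᵥ (V j) := rfl
    have h4 : (V * Vᵀ) 0 j = (V 0) ⬝ᵥ (V j) := rfl
    rw [h3, h2, smul_dotProduct, ← hV0, ← h4, hV, one_apply, Pi.single_apply]
    simp [eq_comm]
  obtain ⟨y, hy, hint, hle⟩ := (hE.mul_mul hU hV').exists_test_vector hd hv hC
  refine hle.trans (integral_mono hint (hE.integrable_topSingularValue_sq (Nat.succ_pos d) C) ?_)
  intro ω
  have h5 := orthogonal_mulVec_dotProduct_le hU' hV' (C + E ω) (y ω)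
  rw [hy, mul_one, Matrix.mul_add, Matrix.add_mul] at h5
  exact h5

end IsGaussianMatrix

end

end

end RankProjection

end

/-! ### Assembling the two bounds -/

theorem mainTheorem2 :
    ∃ c : ℝ, 0 < c ∧ ∃ M₀ : ℕ, ∀ M : ℕ, M₀ ≤ M → ∀ v : ℝ≥0, 0 < v →
      ∀ (Ω : Type*) [MeasurableSpace Ω] (μ : Measure Ω) [IsProbabilityMeasure μ]
        (E : Ω → Matrix (Fin M) (Fin M) ℝ), RankProjection.IsGaussianMatrix μ v E →
        (∀ C : Matrix (Fin M) (Fin M) ℝ, Integrable (fun ω =>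
          RankProjection.hsNormSq (RankProjection.empiricalProj 1 (C + E ω) * (C + E ω))) μ) ∧
        (∀ C P : Matrix (Fin M) (Fin M) ℝ, Integrable (fun ω =>
          RankProjection.hsNormSq (P * (C + E ω))) μ) ∧
        BddBelow (Set.range fun C : Matrix (Fin M) (Fin M) ℝ => RankProjection.delta μ E C 1) ∧
        c * RankProjection.delta μ E 0 1
          ≤ ⨅ C : Matrix (Fin M) (Fin M) ℝ, RankProjection.delta μ E C 1 ∧
        c * ((v : ℝ) * M)
          ≤ ⨅ C : Matrix (Fin M) (Fin M) ℝ, RankProjection.delta μ E C 1 ∧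
        ∀ C : Matrix (Fin M) (Fin M) ℝ,
          c * ((v : ℝ) * M)
            ≤ (∫ ω, RankProjection.topSingularValue (C + E ω) ^ 2 ∂μ)
              - (v : ℝ) * M - RankProjection.topSingularValue C ^ 2 := by
  have hκ := RankProjection.gaussianAbsMean_pos
  set κ := RankProjection.gaussianAbsMean with hκdef
  -- 2432 = 2 · 1216 combines the lower constant κ²/2 with the upper constant 1216. The threshold on
  -- M gives κ² d ≥ κ² + 2 for d = M − 1, which is exactly (d κ² − 1) v ≥ (κ²/2) v (d + 1) when v >
  -- 0.
  refine ⟨κ ^ 2 / 2432, by positivity, ⌈2 / κ ^ 2⌉₊ + 2, ?_⟩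
  intro M hM v hv Ω _ μ _ E hE
  have hM0 : 0 < M := by omega
  have hvM : (0 : ℝ) ≤ v * M := by positivity
  have hdelta : ∀ C, κ ^ 2 / 2 * ((v : ℝ) * M) ≤ RankProjection.delta μ E C 1 := by
    intro C
    obtain ⟨d, rfl⟩ : ∃ d, M = d + 1 := ⟨M - 1, by omega⟩
    have h1 := hE.integral_topSingularValue_sq_ge (by omega) hv C
    rw [hE.delta_eq hM0]
    have h2 : 2 / κ ^ 2 + 1 ≤ d := by
      have h3 : 2 / κ ^ 2 ≤ (⌈2 / κ ^ 2⌉₊ : ℝ) := Nat.le_ceil _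
      have h4 : ((⌈2 / κ ^ 2⌉₊ + 1 : ℕ) : ℝ) ≤ d := by exact_mod_cast (by omega)
      push_cast at h4
      linarith
    have h5 : 2 + κ ^ 2 ≤ κ ^ 2 * d := by
      calc 2 + κ ^ 2 = κ ^ 2 * (2 / κ ^ 2 + 1) := by field_simp
        _ ≤ κ ^ 2 * d := by gcongr
    have h6 := mul_le_mul_of_nonneg_right h5 v.2
    change (2 + κ ^ 2) * (v : ℝ) ≤ κ ^ 2 * d * v at h6
    push_cast
    linarith
  have hc : κ ^ 2 / 2432 * ((v : ℝ) * M) ≤ κ ^ 2 / 2 * (v * M) := by gcongr; norm_num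
  have hzero : κ ^ 2 / 2432 * RankProjection.delta μ E 0 1 ≤ κ ^ 2 / 2 * (v * M) := by
    have h1 := hE.integral_topSingularValue_sq_le hM0 hv
    have h2 : RankProjection.delta μ E 0 1 ≤ 1216 * (v * M) := by
      rw [hE.delta_eq hM0]
      simp only [zero_add]
      linarith [sq_nonneg (RankProjection.topSingularValue (0 : Matrix (Fin M) (Fin M) ℝ))]
    calc κ ^ 2 / 2432 * RankProjection.delta μ E 0 1 ≤ κ ^ 2 / 2432 * (1216 * (v * M)) := by gcongr
      _ = κ ^ 2 / 2 * (v * M) := by ring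
  refine ⟨fun C => ?_, fun C P => hE.integrable_hsNormSq_mul C P, ?_, ?_, ?_, fun C => ?_⟩
  · simp_rw [RankProjection.hsNormSq_empiricalProj_mul hM0]
    exact hE.integrable_topSingularValue_sq hM0 C
  -- Boundedness below makes the real `⨅` a genuine infimum rather than the default value 0.
  · exact ⟨_, Set.forall_mem_range.2 hdelta⟩
  · exact le_ciInf fun C => hzero.trans (hdelta C)
  · exact le_ciInf fun C => hc.trans (hdelta C)
  · rw [← hE.delta_eq hM0]
    exact hc.trans (hdelta C)
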